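/- Let $b>0$, let $N$ be a random variable with values in $\{0,1,2,\dots\}$ and $0<\mu=E[N]<\infty$, and let $X_1,X_2,\dots$ be a sequence of i.i.d. real random variables, independent of $N$, with $\mathbb{P}\{X_1<0\}=\mathbb{P}\{X_1>0\}=\frac12$, $E[X_1]=0$, $E[X_1^2]=2b^2$ and $E[|X_1|^3]=\rho<\infty$. Let $M$ be any integer-valued random variable, defined on the same probability space as $N$ and the $X_i$, with values in $\{0,1,2,\dots\}$ and $\mathbb{P}\{M=m\}=\mu^{-1}\,\mathbb{P}\{N\ge m\}$ for all $m\ge 1$ (so that $M\geq 1$ almost surely). Then $$d_{BL}\Big(\mathscr{L}\Big(\mu^{-1/2}\sum_{i=1}^{N}X_i\Big),\,\mathrm{Laplace}(0,b)\Big)\;\le\;\frac{b+2}{b\sqrt{\mu}}\Big(E|X_1|+\frac{\rho}{6b^2}+b\sqrt2\,E\big[|N-M|^{1/2}\big]\Big),$$ where the right-hand side may be $+\infty$. Here $\mathrm{Laplace}(0,b)$ is the probability distribution on $\mathbb{R}$ with density $\frac{1}{2b}e^{-|x|/b}$, $\mathscr{L}(Y)$ denotes the law of $Y$, and $d_{BL}(\nu_1,\nu_2)=\sup_h\left|\int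 h\,d\nu_1-\int h\,d\nu_2\right|$, the supremum being over all $h:\mathbb{R}\to\mathbb{R}$ with $|h(x)|\le1$ and $|h(x)-h(y)|\le|x-y|$ for all $x,y\in\mathbb{R}$. -/

import Mathlib

open MeasureTheory ProbabilityTheory
open scoped ENNReal

/-- The density `(1 / (2 b)) * exp (-|x - a| / b)` of the Laplace distribution. -/
noncomputable def laplacePDFReal (a b x : ℝ) : ℝ :=
  1 / (2 * b) * Real.exp (-|x - a| / b)

/-- The Laplace distribution with location `a` and scale `b > 0`. -/
noncomputable def laplaceDist (a b : ℝ) : Measure ℝ :=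
  volume.withDensity (fun x => ENNReal.ofReal (laplacePDFReal a b x))

/-- The test functions: bounded by `1` and Lipschitz with constant `1`. -/
def boundedLipschitzClass : Set (ℝ → ℝ) :=
  {h | (∀ x, |h x| ≤ 1) ∧ ∀ x y, |h x - h y| ≤ |x - y|}

/-- The bounded Lipschitz distance between two laws on `ℝ`, with values in `[0, ∞]`;
the supremum is at most `2` when both laws are probability measures. -/
noncomputable def boundedLipschitzDist (ν₁ ν₂ : Measure ℝ) : ℝ≥0∞ :=
  ⨆ h ∈ boundedLipschitzClass, ENNReal.ofReal |(∫ x, h x ∂ν₁) - ∫ x, h x ∂ν₂|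

/-- A function vanishing at `0` whose derivative is `O(s ^ n)` on `[0, ∞)` is `O(s ^ (n + 1))`. -/
lemma abs_le_of_abs_deriv_le_pow {f f' : ℝ → ℝ} {C : ℝ} (n : ℕ)
    (hf : ∀ s, HasDerivAt f (f' s) s) (h0 : f 0 = 0)
    (hC : ∀ s, 0 ≤ s → |f' s| ≤ C * s ^ n) {s : ℝ} (hs : 0 ≤ s) :
    |f s| ≤ C / (n + 1) * s ^ (n + 1) := by
  refine image_norm_le_of_norm_deriv_right_le_deriv_boundary (a := 0) (b := s) (f' := f')
    (B := fun s => C / (n + 1) * s ^ (n + 1)) (B' := fun s => C * s ^ n)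
    (fun x _ => (hf x).continuousAt.continuousWithinAt)
    (fun x _ => (hf x).hasDerivWithinAt) (by simp [h0]) (fun x => ?_)
    (fun x hx => hC x hx.1) ⟨hs, le_rfl⟩
  have := (hasDerivAt_pow (n + 1) x).const_mul (C / (n + 1))
  refine this.congr_deriv ?_
  rw [Nat.add_sub_cancel, Nat.cast_add, Nat.cast_one, ← mul_assoc, div_mul_cancel₀]
  positivity

/-- Taylor's formula of order two with a cubic remainder. -/
lemma abs_taylor_two_le {f f' f'' : ℝ → ℝ} {K : ℝ}
    (hf : ∀ x, HasDerivAt f (f' x) x) (hf' : ∀ x, HasDerivAt f' (f'' x) x)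
    (hK : ∀ x y, |f'' x - f'' y| ≤ K * |x - y|) (a t : ℝ) :
    |f (a + t) - f a - f' a * t - f'' a * t ^ 2 / 2| ≤ K * |t| ^ 3 / 6 := by
  have hline : ∀ s : ℝ, HasDerivAt (fun s => a + s * t) t s := fun s => by
    simpa using ((hasDerivAt_id s).mul_const t).const_add a
  have h1 : ∀ s : ℝ, 0 ≤ s →
      |f' (a + s * t) - f' a - s * (f'' a * t)| ≤ K * t ^ 2 / ((1 : ℕ) + 1) * s ^ (1 + 1) := by
    intro s hs
    refine abs_le_of_abs_deriv_le_pow (f' := fun s => f'' (a + s * t) * t - f'' a * t)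
      (f := fun s => f' (a + s * t) - f' a - s * (f'' a * t)) 1 (fun s => ?_) (by simp)
      (fun s hs => ?_) hs
    · have h := ((hf' (a + s * t)).comp s (hline s)).sub_const (f' a)
      have h := h.sub ((hasDerivAt_id s).mul_const (f'' a * t))
      rw [one_mul] at h
      exact h
    · rw [← sub_mul, abs_mul]
      have := mul_le_mul_of_nonneg_right (hK (a + s * t) a) (abs_nonneg t)
      rw [add_sub_cancel_left, abs_mul, abs_of_nonneg hs] at this
      calc _ ≤ _ := this
        _ = _ := by rw [← sq_abs t]; ring
  have h2 := abs_le_of_abs_deriv_le_pow (s := 1) (C := K * |t| ^ 3 / 2)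
      (f' := fun s => f' (a + s * t) * t - f' a * t - 2 * s * (f'' a * t ^ 2 / 2))
      (f := fun s => f (a + s * t) - f a - s * (f' a * t) - s ^ 2 * (f'' a * t ^ 2 / 2)) 2
      (fun s => ?_) (by simp) (fun s hs => ?_) zero_le_one
  · convert h2 using 1
    · congr 1; simp
    · push_cast; ring
  · have h := ((hf (a + s * t)).comp s (hline s)).sub_const (f a)
    have h := h.sub ((hasDerivAt_id s).mul_const (f' a * t))
    have h := h.sub ((hasDerivAt_pow 2 s).mul_const (f'' a * t ^ 2 / 2))
    rw [one_mul, Nat.cast_ofNat, pow_one] at h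
    exact h
  · have := mul_le_mul_of_nonneg_right (h1 s hs) (abs_nonneg t)
    rw [← abs_mul] at this
    calc _ = |(f' (a + s * t) - f' a - s * (f'' a * t)) * t| := by congr 1; ring
      _ ≤ _ := this
      _ = _ := by rw [← sq_abs t]; push_cast; ring

section Stein

variable {b C : ℝ} {k : ℝ → ℝ}

lemma integrableOn_exp_div_Iic (hb : 0 < b) (x : ℝ) :
    IntegrableOn (fun y => Real.exp (y / b)) (Set.Iic x) := by
  simpa [div_eq_inv_mul] using integrableOn_exp_mul_Iic (inv_pos.2 hb) x

lemma integrableOn_exp_neg_div_Ioi (hb : 0 < b) (x : ℝ) :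
    IntegrableOn (fun y => Real.exp (-y / b)) (Set.Ioi x) := by
  simpa [div_eq_inv_mul] using integrableOn_exp_mul_Ioi (neg_lt_zero.2 (inv_pos.2 hb)) x

lemma integral_exp_div_Iic (hb : 0 < b) (x : ℝ) :
    ∫ y in Set.Iic x, Real.exp (y / b) = b * Real.exp (x / b) := by
  have := integral_exp_mul_Iic (inv_pos.2 hb) x
  simp only [inv_mul_eq_div] at this
  rw [this]; field_simp

lemma integral_exp_neg_div_Ioi (hb : 0 < b) (x : ℝ) :
    ∫ y in Set.Ioi x, Real.exp (-y / b) = b * Real.exp (-x / b) := by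
  have := integral_exp_mul_Ioi (neg_lt_zero.2 (inv_pos.2 hb)) x
  simp only [neg_mul, inv_mul_eq_div, ← neg_div] at this
  rw [this]; field_simp

lemma integrableOn_exp_div_mul_Iic (hb : 0 < b) (hk : Continuous k) (hC : ∀ x, |k x| ≤ C)
    (x : ℝ) : IntegrableOn (fun y => Real.exp (y / b) * k y) (Set.Iic x) :=
  (integrableOn_exp_div_Iic hb x).mul_bdd (c := C) hk.aestronglyMeasurable (ae_of_all _ hC)

lemma integrableOn_exp_neg_div_mul_Ioi (hb : 0 < b) (hk : Continuous k) (hC : ∀ x, |k x| ≤ C)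
    (x : ℝ) : IntegrableOn (fun y => Real.exp (-y / b) * k y) (Set.Ioi x) :=
  (integrableOn_exp_neg_div_Ioi hb x).mul_bdd (c := C) hk.aestronglyMeasurable (ae_of_all _ hC)

/-- The part of the Laplace convolution `∫ exp (-|x - y| / b) * k y` from `y ≤ x`. -/
noncomputable def laplaceConvLeft (b : ℝ) (k : ℝ → ℝ) (x : ℝ) : ℝ :=
  Real.exp (-x / b) * ∫ y in Set.Iic x, Real.exp (y / b) * k y

/-- The part of the Laplace convolution `∫ exp (-|x - y| / b) * k y` from `x < y`. -/
noncomputable def laplaceConvRight (b : ℝ) (k : ℝ → ℝ) (x : ℝ) : ℝ :=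
  Real.exp (x / b) * ∫ y in Set.Ioi x, Real.exp (-y / b) * k y

lemma abs_laplaceConvLeft_le (hb : 0 < b) (hC : ∀ x, |k x| ≤ C) (x : ℝ) :
    |laplaceConvLeft b k x| ≤ b * C := by
  have h : |∫ y in Set.Iic x, Real.exp (y / b) * k y| ≤ b * Real.exp (x / b) * C := by
    have h0 := integral_mul_const (μ := volume.restrict (Set.Iic x)) C fun y => Real.exp (y / b)
    rw [integral_exp_div_Iic hb x] at h0
    rw [← h0]
    refine (Real.norm_eq_abs _).symm.trans_le <| norm_integral_le_of_norm_le
      ((integrableOn_exp_div_Iic hb x).mul_const C)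
      (ae_of_all _ fun y => ?_)
    rw [Real.norm_eq_abs, abs_mul, Real.abs_exp]
    exact mul_le_mul_of_nonneg_left (hC y) (Real.exp_pos _).le
  rw [laplaceConvLeft, abs_mul, Real.abs_exp]
  calc _ ≤ Real.exp (-x / b) * (b * Real.exp (x / b) * C) := by gcongr
    _ = (Real.exp (-x / b) * Real.exp (x / b)) * (b * C) := by ring
    _ = b * C := by rw [← Real.exp_add, neg_div, neg_add_cancel, Real.exp_zero, one_mul]

lemma abs_laplaceConvRight_le (hb : 0 < b) (hC : ∀ x, |k x| ≤ C) (x : ℝ) :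
    |laplaceConvRight b k x| ≤ b * C := by
  have h : |∫ y in Set.Ioi x, Real.exp (-y / b) * k y| ≤ b * Real.exp (-x / b) * C := by
    have h0 := integral_mul_const (μ := volume.restrict (Set.Ioi x)) C fun y => Real.exp (-y / b)
    rw [integral_exp_neg_div_Ioi hb x] at h0
    rw [← h0]
    refine (Real.norm_eq_abs _).symm.trans_le <| norm_integral_le_of_norm_le
      ((integrableOn_exp_neg_div_Ioi hb x).mul_const C)
      (ae_of_all _ fun y => ?_)
    rw [Real.norm_eq_abs, abs_mul, Real.abs_exp]
    exact mul_le_mul_of_nonneg_left (hC y) (Real.exp_pos _).le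
  rw [laplaceConvRight, abs_mul, Real.abs_exp]
  calc _ ≤ Real.exp (x / b) * (b * Real.exp (-x / b) * C) := by gcongr
    _ = (Real.exp (x / b) * Real.exp (-x / b)) * (b * C) := by ring
    _ = b * C := by rw [← Real.exp_add, neg_div, add_neg_cancel, Real.exp_zero, one_mul]

lemma hasDerivAt_setIntegral_Iic {f : ℝ → ℝ} (hf : Continuous f)
    (hi : ∀ x, IntegrableOn f (Set.Iic x)) (x : ℝ) :
    HasDerivAt (fun x => ∫ y in Set.Iic x, f y) (f x) x := by
  have h : (fun x => ∫ y in Set.Iic x, f y) =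
      fun x => (∫ y in (0 : ℝ)..x, f y) + ∫ y in Set.Iic 0, f y := by
    funext z
    rw [← intervalIntegral.integral_Iic_sub_Iic (hi 0) (hi z), sub_add_cancel]
  rw [h]
  exact (intervalIntegral.integral_hasDerivAt_right (hf.intervalIntegrable _ _)
    (hf.stronglyMeasurableAtFilter _ _) hf.continuousAt).add_const _

lemma hasDerivAt_setIntegral_Ioi {f : ℝ → ℝ} (hf : Continuous f)
    (hi : ∀ x, IntegrableOn f (Set.Ioi x)) (x : ℝ) :
    HasDerivAt (fun x => ∫ y in Set.Ioi x, f y) (-f x) x := by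
  have h : (fun x => ∫ y in Set.Ioi x, f y) =
      fun x => (∫ y in Set.Ioi 0, f y) - ∫ y in (0 : ℝ)..x, f y := by
    funext z
    rw [← intervalIntegral.integral_interval_add_Ioi (hi 0) (hi z)]
    ring
  rw [h]
  exact (intervalIntegral.integral_hasDerivAt_right (hf.intervalIntegrable _ _)
    (hf.stronglyMeasurableAtFilter _ _) hf.continuousAt).const_sub _

lemma hasDerivAt_laplaceConvLeft (hb : 0 < b) (hk : Continuous k) (hC : ∀ x, |k x| ≤ C)
    (x : ℝ) : HasDerivAt (laplaceConvLeft b k) (k x - laplaceConvLeft b k x / b) x := by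
  have h1 : HasDerivAt (fun x : ℝ => Real.exp (-x / b)) (Real.exp (-x / b) * (-1 / b)) x :=
    ((hasDerivAt_id x).neg.div_const b).exp
  have h2 := h1.mul (hasDerivAt_setIntegral_Iic (by fun_prop)
    (integrableOn_exp_div_mul_Iic hb hk hC) x)
  refine h2.congr_deriv ?_
  rw [← mul_assoc (Real.exp (-x / b)), ← Real.exp_add, neg_div, neg_add_cancel, laplaceConvLeft]
  simp only [Real.exp_zero, neg_div]
  ring

lemma hasDerivAt_laplaceConvRight (hb : 0 < b) (hk : Continuous k) (hC : ∀ x, |k x| ≤ C)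
    (x : ℝ) : HasDerivAt (laplaceConvRight b k) (laplaceConvRight b k x / b - k x) x := by
  have h1 : HasDerivAt (fun x : ℝ => Real.exp (x / b)) (Real.exp (x / b) * (1 / b)) x :=
    ((hasDerivAt_id x).div_const b).exp
  have h2 := h1.mul (hasDerivAt_setIntegral_Ioi (by fun_prop)
    (integrableOn_exp_neg_div_mul_Ioi hb hk hC) x)
  refine h2.congr_deriv ?_
  rw [mul_neg, ← mul_assoc (Real.exp (x / b)) (Real.exp _), ← Real.exp_add, neg_div,
    add_neg_cancel, laplaceConvRight]
  simp only [Real.exp_zero]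
  ring

/-- Integrals of bounded continuous functions against the Laplace law. -/
lemma integral_laplaceDist (hb : 0 < b) (hk : Continuous k) (hC : ∀ x, |k x| ≤ C) :
    ∫ x, k x ∂(laplaceDist 0 b)
      = 1 / (2 * b) * (laplaceConvLeft b k 0 + laplaceConvRight b k 0) := by
  have hm : Measurable (laplacePDFReal 0 b) := by unfold laplacePDFReal; fun_prop
  have hnn : ∀ x, 0 ≤ laplacePDFReal 0 b x := fun x => by unfold laplacePDFReal; positivity
  have hl : Set.EqOn (fun x => laplacePDFReal 0 b x * k x)
      (fun y => 1 / (2 * b) * (Real.exp (y / b) * k y)) (Set.Iic 0) := fun y hy => by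
    simp only [laplacePDFReal, sub_zero, abs_of_nonpos (Set.mem_Iic.1 hy), neg_neg, mul_assoc]
  have hr : Set.EqOn (fun x => laplacePDFReal 0 b x * k x)
      (fun y => 1 / (2 * b) * (Real.exp (-y / b) * k y)) (Set.Ioi 0) := fun y hy => by
    simp only [laplacePDFReal, sub_zero, abs_of_pos (Set.mem_Ioi.1 hy), mul_assoc]
  rw [laplaceDist, integral_withDensity_eq_integral_toReal_smul (by fun_prop)
    (ae_of_all _ fun _ => ENNReal.ofReal_lt_top)]
  simp only [ENNReal.toReal_ofReal (hnn _), smul_eq_mul]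
  rw [← intervalIntegral.integral_Iic_add_Ioi (b := (0 : ℝ)),
    setIntegral_congr_fun measurableSet_Iic hl, setIntegral_congr_fun measurableSet_Ioi hr,
    integral_const_mul, integral_const_mul, ← mul_add]
  · simp [laplaceConvLeft, laplaceConvRight]
  · exact (integrableOn_congr_fun hl measurableSet_Iic).2
      ((integrableOn_exp_div_mul_Iic hb hk hC 0).const_mul _)
  · exact (integrableOn_congr_fun hr measurableSet_Ioi).2
      ((integrableOn_exp_neg_div_mul_Ioi hb hk hC 0).const_mul _)

lemma laplaceConv_const (hb : 0 < b) (c : ℝ) :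
    laplaceConvLeft b (fun _ => c) 0 + laplaceConvRight b (fun _ => c) 0 = 2 * b * c := by
  simp only [laplaceConvLeft, laplaceConvRight, integral_mul_const, integral_exp_div_Iic hb,
    integral_exp_neg_div_Ioi hb]
  simp
  ring

lemma integral_laplaceDist_const (hb : 0 < b) (c : ℝ) : ∫ _, c ∂(laplaceDist 0 b) = c := by
  rw [integral_laplaceDist hb continuous_const (C := |c|) (fun _ => le_rfl), laplaceConv_const hb]
  field_simp

lemma isProbabilityMeasure_laplaceDist (hb : 0 < b) :
    IsProbabilityMeasure (laplaceDist 0 b) := by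
  have h := integral_laplaceDist_const hb 1
  rw [integral_const, smul_eq_mul, mul_one] at h
  exact ⟨by simpa [Measure.real, ENNReal.toReal_eq_one_iff] using h⟩

/-- The solution of the Stein equation of the Laplace law, with its bounds. -/
lemma exists_laplace_stein_solution (hb : 0 < b) {h : ℝ → ℝ} (hh : h ∈ boundedLipschitzClass) :
    ∃ g g' g'' : ℝ → ℝ, (∀ x, HasDerivAt g (g' x) x) ∧ (∀ x, HasDerivAt g' (g'' x) x) ∧
      g 0 = 0 ∧ (∀ x, |g x| ≤ 2) ∧ (∀ x, |g' x| ≤ 2 / b) ∧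
      (∀ x y, |b ^ 2 * g'' x - b ^ 2 * g'' y| ≤ (b + 2) / b * |x - y|) ∧
      ∀ x, g x - b ^ 2 * g'' x = h x - ∫ y, h y ∂(laplaceDist 0 b) := by
  have := isProbabilityMeasure_laplaceDist hb
  have hc : Continuous h := (LipschitzWith.of_dist_le_mul (K := 1) fun x y => by
    simpa [Real.dist_eq] using hh.2 x y).continuous
  set m := ∫ y, h y ∂(laplaceDist 0 b) with hm
  have hm1 : |m| ≤ 1 := by
    simpa using norm_integral_le_of_norm_le_const (μ := laplaceDist 0 b) (f := h)
      (ae_of_all _ fun x => (Real.norm_eq_abs _).trans_le (hh.1 x))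
  set k : ℝ → ℝ := fun x => h x - m with hk
  have hkc : Continuous k := hc.sub continuous_const
  have hkC : ∀ x, |k x| ≤ 2 := fun x => by
    have := abs_sub (h x) m
    have := hh.1 x
    simp only [hk]; linarith
  have hi : Integrable h (laplaceDist 0 b) :=
    Integrable.of_bound hc.aestronglyMeasurable 1
      (ae_of_all _ fun x => (Real.norm_eq_abs _).trans_le (hh.1 x))
  have hk0 : ∫ x, k x ∂(laplaceDist 0 b) = 0 := by
    simp only [hk]
    rw [integral_sub hi (integrable_const _), integral_laplaceDist_const hb, ← hm, sub_self]
  set l := laplaceConvLeft b k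
  set r := laplaceConvRight b k
  have hl := abs_laplaceConvLeft_le hb hkC
  have hr := abs_laplaceConvRight_le hb hkC
  have hl' := hasDerivAt_laplaceConvLeft hb hkc hkC
  have hr' := hasDerivAt_laplaceConvRight hb hkc hkC
  have hg : ∀ x, HasDerivAt (fun x => 1 / (2 * b) * (l x + r x))
      (1 / (2 * b ^ 2) * (r x - l x)) x := fun x => by
    refine (((hl' x).add (hr' x)).const_mul (1 / (2 * b))).congr_deriv ?_
    simp only [l, r]
    field_simp
    ring
  have hgb : ∀ x, |1 / (2 * b ^ 2) * (r x - l x)| ≤ 2 / b := fun x => by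
    rw [abs_mul, abs_of_pos (by positivity)]
    calc _ ≤ 1 / (2 * b ^ 2) * (b * 2 + b * 2) := by
          gcongr
          exact (abs_sub _ _).trans (add_le_add (hr x) (hl x))
      _ = _ := by field_simp; ring
  refine ⟨fun x => 1 / (2 * b) * (l x + r x), fun x => 1 / (2 * b ^ 2) * (r x - l x),
    fun x => 1 / b ^ 2 * (1 / (2 * b) * (l x + r x) - k x), hg, fun x => ?_, ?_, fun x => ?_,
    hgb, fun x y => ?_, fun x => ?_⟩
  · refine (((hr' x).sub (hl' x)).const_mul (1 / (2 * b ^ 2))).congr_deriv ?_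
    simp only [l, r]
    field_simp
    ring
  · exact (integral_laplaceDist hb hkc hkC).symm.trans hk0
  · rw [abs_mul, abs_of_pos (by positivity)]
    calc _ ≤ 1 / (2 * b) * (b * 2 + b * 2) := by
          gcongr
          exact (abs_add_le _ _).trans (add_le_add (hl x) (hr x))
      _ = _ := by field_simp; ring
  · have h1 : |1 / (2 * b) * (l x + r x) - 1 / (2 * b) * (l y + r y)| ≤ 2 / b * |x - y| :=
      convex_univ.norm_image_sub_le_of_norm_hasDerivWithin_le
        (fun z _ => (hg z).hasDerivWithinAt) (fun z _ => hgb z) (Set.mem_univ y) (Set.mem_univ x)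
    have h2 := hh.2 x y
    have h3 : b ^ 2 * (1 / b ^ 2 * (1 / (2 * b) * (l x + r x) - k x))
        - b ^ 2 * (1 / b ^ 2 * (1 / (2 * b) * (l y + r y) - k y))
        = (1 / (2 * b) * (l x + r x) - 1 / (2 * b) * (l y + r y)) - (h x - h y) := by
      simp only [hk]; field_simp; ring
    rw [h3]
    calc _ ≤ _ := abs_sub _ _
      _ ≤ 2 / b * |x - y| + |x - y| := add_le_add h1 h2
      _ = _ := by field_simp; ring
  · simp only [hk]; field_simp; ring

end Stein

section RandomSum

variable {Ω : Type*} [MeasurableSpace Ω] {P : Measure Ω}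

lemma tsum_measure_lt_eq_lintegral {N : Ω → ℕ} (hN : Measurable N) :
    ∑' k, P {ω | k < N ω} = ∫⁻ ω, (N ω : ℝ≥0∞) ∂P := by
  have hm : ∀ k, MeasurableSet {ω | k < N ω} := fun k => hN measurableSet_Ioi
  calc ∑' k, P {ω | k < N ω} = ∑' k, ∫⁻ ω, {ω | k < N ω}.indicator (fun _ => 1) ω ∂P := by
        simp [lintegral_indicator (hm _)]
    _ = ∫⁻ ω, ∑' k, {ω | k < N ω}.indicator (fun _ => (1 : ℝ≥0∞)) ω ∂P :=
        (lintegral_tsum fun k => (measurable_const.indicator (hm k)).aemeasurable).symm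
    _ = _ := by
        congr 1 with ω
        rw [tsum_eq_sum (s := Finset.range (N ω))
          (fun k hk => Set.indicator_of_notMem (by simpa using hk) _)]
        rw [Finset.sum_congr rfl fun k hk =>
          Set.indicator_of_mem (s := {ω | k < N ω}) (by simpa using hk) _]
        simp

lemma summable_measureReal_lt {N : Ω → ℕ} (hN : Measurable N)
    (hi : Integrable (fun ω => (N ω : ℝ)) P) : Summable fun k => P.real {ω | k < N ω} := by
  refine ENNReal.summable_toReal ?_
  rw [tsum_measure_lt_eq_lintegral hN]
  have := hi.lintegral_lt_top
  simpa using this.ne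

variable [IsProbabilityMeasure P]

/-- Fubini's theorem for a function of two independent variables. -/
lemma integral_comp_of_indepFun {α β : Type*} [MeasurableSpace α] [MeasurableSpace β]
    {f : Ω → α} {g : Ω → β} {F : α × β → ℝ} (hf : Measurable f) (hg : Measurable g)
    (hfg : IndepFun f g P) (hF : Measurable F) (hi : Integrable (fun ω => F (f ω, g ω)) P) :
    ∫ ω, F (f ω, g ω) ∂P = ∫ ω, (∫ ω', F (f ω, g ω') ∂P) ∂P := by
  have hlaw := (indepFun_iff_map_prod_eq_prod_map_map hf.aemeasurable hg.aemeasurable).1 hfg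
  have hP : Integrable F ((P.map f).prod (P.map g)) := by
    rw [← hlaw]
    exact (integrable_map_measure hF.aestronglyMeasurable (hf.prodMk hg).aemeasurable).2 hi
  have := Measure.isProbabilityMeasure_map (μ := P) hg.aemeasurable
  have := Measure.isProbabilityMeasure_map (μ := P) hf.aemeasurable
  rw [← integral_map (hf.prodMk hg).aemeasurable hF.aestronglyMeasurable, hlaw,
    integral_prod _ hP, integral_map hf.aemeasurable]
  · congr 1 with ω
    rw [integral_map hg.aemeasurable]
    exact (hF.comp measurable_prodMk_left).aestronglyMeasurable
  · exact (hF.stronglyMeasurable.integral_prod_right' (ν := P.map g)).aestronglyMeasurable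

/-- Summation by parts: the mean of `∑ k < N, d k` through the tails of `N`. -/
lemma hasSum_integral_sum_range {N : Ω → ℕ} (hN : Measurable N)
    (hi : Integrable (fun ω => (N ω : ℝ)) P) {d : ℕ → ℝ} {C : ℝ} (hd : ∀ k, |d k| ≤ C) :
    HasSum (fun k => P.real {ω | k < N ω} * d k)
      (∫ ω, ∑ k ∈ Finset.range (N ω), d k ∂P) := by
  have hm : ∀ k, MeasurableSet {ω | k < N ω} := fun k => hN measurableSet_Ioi
  have h := hasSum_integral_of_summable_integral_norm (μ := P)
    (F := fun k => {ω | k < N ω}.indicator fun _ => d k)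
    (fun k => (integrable_const _).indicator (hm k)) ?_
  · simp only [integral_indicator_const _ (hm _), smul_eq_mul] at h
    have hω : ∀ ω, ∑' k, {ω | k < N ω}.indicator (fun _ => d k) ω
        = ∑ k ∈ Finset.range (N ω), d k := fun ω => by
      rw [tsum_eq_sum (s := Finset.range (N ω))
        (fun k hk => Set.indicator_of_notMem (by simpa using hk) _)]
      exact Finset.sum_congr rfl fun k hk =>
        Set.indicator_of_mem (s := {ω | k < N ω}) (by simpa using hk) _
    simpa only [hω] using h
  · refine Summable.of_nonneg_of_le (fun k => by positivity) (fun k => ?_)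
      ((summable_measureReal_lt hN hi).mul_right C)
    simp only [norm_indicator_eq_indicator_norm]
    rw [integral_indicator_const _ (hm k), smul_eq_mul]
    exact mul_le_mul_of_nonneg_left (hd k) measureReal_nonneg

lemma hasSum_integral_pred {M : Ω → ℕ} (hM : Measurable M) {d : ℕ → ℝ} {C : ℝ}
    (hd : ∀ k, |d k| ≤ C) :
    HasSum (fun k => P.real {ω | M ω = k + 1} * d k)
      (∫ ω, {ω | 1 ≤ M ω}.indicator (fun ω => d (M ω - 1)) ω ∂P) := by
  have hm : ∀ k, MeasurableSet {ω | M ω = k + 1} := fun k => hM (measurableSet_singleton _)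
  have hsum : Summable fun k => P.real {ω | M ω = k + 1} := by
    refine ENNReal.summable_toReal ?_
    rw [← measure_iUnion (fun i j hij => Set.disjoint_left.2 fun ω h1 h2 => hij ?_) hm]
    · exact measure_ne_top _ _
    · simp only [Set.mem_ofPred_eq] at h1 h2
      omega
  have h := hasSum_integral_of_summable_integral_norm (μ := P)
    (F := fun k => {ω | M ω = k + 1}.indicator fun _ => d k)
    (fun k => (integrable_const _).indicator (hm k)) ?_
  · simp only [integral_indicator_const _ (hm _), smul_eq_mul] at h
    have hω : ∀ ω, ∑' k, {ω | M ω = k + 1}.indicator (fun _ => d k) ω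
        = {ω | 1 ≤ M ω}.indicator (fun ω => d (M ω - 1)) ω := fun ω => by
      rw [tsum_eq_single (M ω - 1) fun k hk => Set.indicator_of_notMem
        (by rw [Set.mem_ofPred_eq]; omega) _]
      by_cases h1 : 1 ≤ M ω
      · rw [Set.indicator_of_mem (s := {ω | 1 ≤ M ω}) h1, Set.indicator_of_mem]
        rw [Set.mem_ofPred_eq]; omega
      · rw [Set.indicator_of_notMem (s := {ω | 1 ≤ M ω}) h1, Set.indicator_of_notMem]
        rw [Set.mem_ofPred_eq]; omega
    simpa only [hω] using h
  · refine Summable.of_nonneg_of_le (fun k => by positivity) (fun k => ?_)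
      (hsum.mul_right C)
    simp only [norm_indicator_eq_indicator_norm]
    rw [integral_indicator_const _ (hm k), smul_eq_mul]
    exact mul_le_mul_of_nonneg_left (hd k) measureReal_nonneg

/-- If `M` has the law `μ⁻¹ P(N ≥ m)` on `m ≥ 1`, then `E ∑ k < N, d k = μ E d (M - 1)`. -/
lemma integral_sum_range_eq {N M : Ω → ℕ} {μ : ℝ} (hN : Measurable N) (hM : Measurable M)
    (hi : Integrable (fun ω => (N ω : ℝ)) P) (hμ : 0 < μ)
    (hlaw : ∀ m : ℕ, 1 ≤ m → P.real {ω | M ω = m} = μ⁻¹ * P.real {ω | m ≤ N ω})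
    {d : ℕ → ℝ} {C : ℝ} (hd : ∀ k, |d k| ≤ C) :
    ∫ ω, ∑ k ∈ Finset.range (N ω), d k ∂P
      = μ * ∫ ω, {ω | 1 ≤ M ω}.indicator (fun ω => d (M ω - 1)) ω ∂P := by
  refine (hasSum_integral_sum_range hN hi hd).unique ?_
  have hk : ∀ k, P.real {ω | k < N ω} * d k = μ * (P.real {ω | M ω = k + 1} * d k) := fun k => by
    rw [hlaw (k + 1) (Nat.le_add_left 1 k)]
    simp only [Nat.add_one_le_iff]
    field_simp
  simpa only [hk] using (hasSum_integral_pred (P := P) hM hd).mul_left μ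

lemma ae_one_le {N M : Ω → ℕ} {μ : ℝ} (hN : Measurable N) (hM : Measurable M)
    (hi : Integrable (fun ω => (N ω : ℝ)) P) (hμ : 0 < μ) (hmean : ∫ ω, (N ω : ℝ) ∂P = μ)
    (hlaw : ∀ m : ℕ, 1 ≤ m → P.real {ω | M ω = m} = μ⁻¹ * P.real {ω | m ≤ N ω}) :
    ∀ᵐ ω ∂P, 1 ≤ M ω := by
  have hm : MeasurableSet {ω | 1 ≤ M ω} := hM measurableSet_Ici
  have h := integral_sum_range_eq hN hM hi hμ hlaw (d := fun _ => 1) (C := 1) (by simp)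
  rw [integral_indicator_const _ hm] at h
  simp only [Finset.sum_const, Finset.card_range, nsmul_eq_mul, mul_one, smul_eq_mul, hmean] at h
  have h1 : P.real {ω | 1 ≤ M ω} = 1 := (mul_eq_left₀ hμ.ne').1 h.symm
  rw [Measure.real, ENNReal.toReal_eq_one_iff] at h1
  exact (prob_compl_eq_zero_iff hm).2 h1

variable {X : ℕ → Ω → ℝ}

/-- Two partial sums of centred i.i.d. variables differ by `√(s |m - n|)` in mean. -/
lemma integral_abs_sum_sub_sum_le {s : ℝ} (hind : iIndepFun X P) (hL : ∀ i, MemLp (X i) 2 P)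
    (h0 : ∀ i, ∫ ω, X i ω ∂P = 0) (h2 : ∀ i, ∫ ω, X i ω ^ 2 ∂P = s) (m n : ℕ) :
    ∫ ω, |∑ i ∈ Finset.range m, X i ω - ∑ i ∈ Finset.range n, X i ω| ∂P
      ≤ √(s * |(m : ℝ) - n|) := by
  wlog hmn : m ≤ n generalizing m n
  · simpa only [abs_sub_comm] using this n m (not_le.1 hmn).le
  have hY : MemLp (∑ i ∈ Finset.Ico m n, X i) 2 P := memLp_finsetSum' _ fun i _ => hL i
  have hvar : Var[∑ i ∈ Finset.Ico m n, X i; P] = s * (n - m) := by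
    rw [IndepFun.variance_sum (fun i _ => hL i) fun i _ j _ hij => hind.indepFun hij]
    rw [Finset.sum_congr rfl fun i _ => variance_of_integral_eq_zero (hL i).aemeasurable (h0 i)]
    simp [h2, Nat.cast_sub hmn, mul_comm]
  have hmean : ∫ ω, (∑ i ∈ Finset.Ico m n, X i) ω ∂P = 0 := by
    simp only [Finset.sum_apply]
    rw [integral_finsetSum _ fun i _ => (hL i).integrable one_le_two]
    simp [h0]
  rw [variance_of_integral_eq_zero hY.aemeasurable hmean] at hvar
  have habs := variance_nonneg |∑ i ∈ Finset.Ico m n, X i| P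
  rw [variance_eq_sub hY.abs] at habs
  simp only [Pi.pow_apply, Pi.abs_apply, sq_abs, hvar] at habs
  have he : ∀ ω, |∑ i ∈ Finset.range m, X i ω - ∑ i ∈ Finset.range n, X i ω|
      = |(∑ i ∈ Finset.Ico m n, X i) ω| := fun ω => by
    rw [abs_sub_comm, Finset.sum_apply, Finset.sum_Ico_eq_sub _ hmn]
  simp only [he]
  refine Real.le_sqrt_of_sq_le ?_
  rw [abs_sub_comm, abs_of_nonneg (by simpa using hmn)]
  linarith

/-- One Taylor step, with an increment `c Y` independent of the starting point `A`. -/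
lemma abs_integral_step_sub_le {A Y : Ω → ℝ} (hA : Measurable A) (hY : Measurable Y)
    (hAY : IndepFun A Y P) (h3 : Integrable (fun ω => |Y ω| ^ 3) P) (hL : MemLp Y 2 P)
    (h0 : ∫ ω, Y ω ∂P = 0) {f f' f'' : ℝ → ℝ} {C₀ C₁ C₂ K : ℝ}
    (hf : ∀ x, HasDerivAt f (f' x) x) (hf' : ∀ x, HasDerivAt f' (f'' x) x)
    (hf'' : Measurable f'')
    (hC₀ : ∀ x, |f x| ≤ C₀) (hC₁ : ∀ x, |f' x| ≤ C₁) (hC₂ : ∀ x, |f'' x| ≤ C₂)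
    (hK : ∀ x y, |f'' x - f'' y| ≤ K * |x - y|) {c : ℝ} (hc : 0 ≤ c) :
    |∫ ω, f (A ω + c * Y ω) ∂P - ∫ ω, f (A ω) ∂P
        - c ^ 2 / 2 * (∫ ω, f'' (A ω) ∂P) * ∫ ω, Y ω ^ 2 ∂P|
      ≤ K * c ^ 3 / 6 * ∫ ω, |Y ω| ^ 3 ∂P := by
  have hfm : Measurable f := (continuous_iff_continuousAt.2 fun x => (hf x).continuousAt).measurable
  have hfm' : Measurable f' :=
    (continuous_iff_continuousAt.2 fun x => (hf' x).continuousAt).measurable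
  have i1 : Integrable (fun ω => f (A ω + c * Y ω)) P := .of_bound
    (hfm.comp (hA.add (hY.const_mul c))).aestronglyMeasurable C₀ (ae_of_all _ fun _ => hC₀ _)
  have i2 : Integrable (fun ω => f (A ω)) P := .of_bound
    (hfm.comp hA).aestronglyMeasurable C₀ (ae_of_all _ fun _ => hC₀ _)
  have i3 : Integrable (fun ω => f' (A ω) * (c * Y ω)) P :=
    ((hL.integrable one_le_two).const_mul c).bdd_mul (c := C₁)
      (hfm'.comp hA).aestronglyMeasurable (ae_of_all _ fun _ => hC₁ _)
  have i4 : Integrable (fun ω => f'' (A ω) * (c * Y ω) ^ 2 / 2) P := by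
    refine Integrable.div_const (Integrable.bdd_mul (c := C₂) ?_
      (hf''.comp hA).aestronglyMeasurable (ae_of_all _ fun _ => hC₂ _)) 2
    simpa only [mul_pow] using hL.integrable_sq.const_mul (c ^ 2)
  have e3 : ∫ ω, f' (A ω) * (c * Y ω) ∂P = 0 := by
    have := hAY.integral_fun_comp_mul_comp hA.aemeasurable hY.aemeasurable
      hfm'.aestronglyMeasurable (measurable_const_mul c).aestronglyMeasurable
    rw [this, integral_const_mul, h0, mul_zero, mul_zero]
  have e4 : ∫ ω, f'' (A ω) * (c * Y ω) ^ 2 / 2 ∂P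
      = c ^ 2 / 2 * (∫ ω, f'' (A ω) ∂P) * ∫ ω, Y ω ^ 2 ∂P := by
    have := hAY.integral_fun_comp_mul_comp (g := fun y => (c * y) ^ 2) hA.aemeasurable
      hY.aemeasurable hf''.aestronglyMeasurable (by fun_prop)
    rw [integral_div, this]
    simp only [mul_pow, integral_const_mul]
    ring
  have e : ∫ ω, (f (A ω + c * Y ω) - f (A ω) - f' (A ω) * (c * Y ω)
      - f'' (A ω) * (c * Y ω) ^ 2 / 2) ∂P = ∫ ω, f (A ω + c * Y ω) ∂P - ∫ ω, f (A ω) ∂P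
        - c ^ 2 / 2 * (∫ ω, f'' (A ω) ∂P) * ∫ ω, Y ω ^ 2 ∂P := by
    rw [integral_sub (by exact (i1.sub i2).sub i3) i4, integral_sub (by exact i1.sub i2) i3,
      integral_sub i1 i2, e3, e4, sub_zero]
  rw [← e, ← integral_const_mul]
  refine (Real.norm_eq_abs _).symm.trans_le <|
    norm_integral_le_of_norm_le (h3.const_mul _) (ae_of_all _ fun ω => ?_)
  refine (abs_taylor_two_le hf hf' hK (A ω) (c * Y ω)).trans_eq ?_
  rw [abs_mul, abs_of_nonneg hc]
  ring

/-- The expected value of a bounded function of the scaled random sum, by conditioning on the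
number of summands. -/
lemma integral_randomSum {X : ℕ → Ω → ℝ} {N : Ω → ℕ} (hX : ∀ i, Measurable (X i))
    (hN : Measurable N) (hXN : IndepFun N (fun ω i => X i ω) P) {f : ℝ → ℝ} (hf : Measurable f)
    {C : ℝ} (hC : ∀ x, |f x| ≤ C) (c : ℝ) :
    ∫ ω, f (c * ∑ i ∈ Finset.range (N ω), X i ω) ∂P
      = ∫ ω, (∫ ω', f (c * ∑ i ∈ Finset.range (N ω), X i ω') ∂P) ∂P := by
  have hF : Measurable fun p : ℕ × (ℕ → ℝ) => f (c * ∑ i ∈ Finset.range p.1, p.2 i) :=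
    measurable_from_prod_countable_right fun n => by
      dsimp only
      fun_prop
  have hXm : Measurable fun ω i => X i ω := measurable_pi_lambda _ hX
  exact integral_comp_of_indepFun hN hXm hXN hF
    (.of_bound (hF.comp (hN.prodMk hXm)).aestronglyMeasurable C (ae_of_all _ fun _ => hC _))

lemma abs_integral_le_of_abs_le {f : Ω → ℝ} {C : ℝ} (hC : ∀ ω, |f ω| ≤ C) :
    |∫ ω, f ω ∂P| ≤ C := by
  simpa using norm_integral_le_of_norm_le_const (μ := P) (f := f)
    (ae_of_all _ fun x => (Real.norm_eq_abs _).trans_le (hC x))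

/-- The distance between a step of the partial sums, read through `g`, and the second derivative
of `g` at another partial sum. -/
lemma abs_step_sub_le {X : ℕ → Ω → ℝ} {b μ ρ L C₀ C₁ C₂ c : ℝ} (hX : ∀ i, Measurable (X i))
    (hb : 0 < b) (hμ : 0 < μ) (hind : iIndepFun X P)
    (h3 : ∀ i, Integrable (fun ω => |X i ω| ^ 3) P) (hL : ∀ i, MemLp (X i) 2 P)
    (h0 : ∀ i, ∫ ω, X i ω ∂P = 0) (hvar : ∀ i, ∫ ω, X i ω ^ 2 ∂P = 2 * b ^ 2)
    (hρ : ∀ i, ∫ ω, |X i ω| ^ 3 ∂P = ρ) (hc : 0 ≤ c) (hcμ : μ * c ^ 2 = 1)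
    {g g' g'' : ℝ → ℝ} (hg : ∀ x, HasDerivAt g (g' x) x) (hg' : ∀ x, HasDerivAt g' (g'' x) x)
    (hC₀ : ∀ x, |g x| ≤ C₀) (hC₁ : ∀ x, |g' x| ≤ C₁) (hC₂ : ∀ x, |g'' x| ≤ C₂) (hLnn : 0 ≤ L)
    (hlip : ∀ x y, |b ^ 2 * g'' x - b ^ 2 * g'' y| ≤ L * |x - y|) (hgm : Measurable g'')
    (m n : ℕ) :
    |μ * (∫ ω, g (c * ∑ i ∈ Finset.range (m + 1), X i ω) ∂P
          - ∫ ω, g (c * ∑ i ∈ Finset.range m, X i ω) ∂P)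
        - b ^ 2 * ∫ ω, g'' (c * ∑ i ∈ Finset.range n, X i ω) ∂P|
      ≤ L * c * (∫ ω, |X m ω| ∂P + ρ / (6 * b ^ 2)
          + b * √2 * |(n : ℝ) - ((m + 1 : ℕ) : ℝ)| ^ (1 / 2 : ℝ)) := by
  have hS : ∀ n, Measurable fun ω => ∑ i ∈ Finset.range n, X i ω := fun n =>
    Finset.measurable_sum _ fun i _ => hX i
  have hSL : ∀ n, MemLp (fun ω => ∑ i ∈ Finset.range n, X i ω) 2 P := fun n =>
    memLp_finsetSum _ fun i _ => hL i
  have hXi : ∀ i, Integrable (X i) P := fun i => (hL i).integrable one_le_two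
  have hSi : ∀ n, Integrable (fun ω => ∑ i ∈ Finset.range n, X i ω) P := fun n =>
    (hSL n).integrable one_le_two
  have hg2 : ∀ n, Integrable (fun ω => b ^ 2 * g'' (c * ∑ i ∈ Finset.range n, X i ω)) P :=
    fun n => (Integrable.of_bound (hgm.comp ((hS n).const_mul c)).aestronglyMeasurable C₂
      (ae_of_all _ fun _ => hC₂ _)).const_mul _
  have hK : ∀ x y, |g'' x - g'' y| ≤ L / b ^ 2 * |x - y| := fun x y => by
    have h := hlip x y
    rw [← mul_sub, abs_mul, abs_of_pos (by positivity)] at h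
    rw [div_mul_eq_mul_div, le_div_iff₀ (by positivity)]
    linarith
  have hindS : IndepFun (fun ω => c * ∑ i ∈ Finset.range m, X i ω) (X m) P := by
    have h := (hind.indepFun_sum_range_succ hX m).comp (measurable_const_mul c) measurable_id
    have e : (c * ·) ∘ (∑ j ∈ Finset.range m, X j)
        = fun ω => c * ∑ i ∈ Finset.range m, X i ω := by ext ω; simp
    rwa [e] at h
  have step := abs_integral_step_sub_le ((hS m).const_mul c) (hX m) hindS (h3 m) (hL m) (h0 m)
    hg hg' hgm hC₀ hC₁ hC₂ hK hc
  rw [hvar, hρ] at step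
  have e1 : ∀ ω, c * ∑ i ∈ Finset.range m, X i ω + c * X m ω
      = c * ∑ i ∈ Finset.range (m + 1), X i ω := fun ω => by rw [Finset.sum_range_succ, mul_add]
  simp only [e1] at step
  have t1 : |μ * (∫ ω, g (c * ∑ i ∈ Finset.range (m + 1), X i ω) ∂P
          - ∫ ω, g (c * ∑ i ∈ Finset.range m, X i ω) ∂P)
        - b ^ 2 * ∫ ω, g'' (c * ∑ i ∈ Finset.range m, X i ω) ∂P| ≤ L * c * (ρ / (6 * b ^ 2)) := by
    have := mul_le_mul_of_nonneg_left step hμ.le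
    rw [← abs_of_pos hμ, ← abs_mul, abs_of_pos hμ] at this
    calc _ = _ := by
          congr 1
          linear_combination (b ^ 2 * ∫ ω, g'' (c * ∑ i ∈ Finset.range m, X i ω) ∂P) * hcμ
      _ ≤ _ := this
      _ = _ := by
          field_simp
          linear_combination (L * c * ρ) * hcμ
  have t2 : |b ^ 2 * ∫ ω, g'' (c * ∑ i ∈ Finset.range m, X i ω) ∂P
      - b ^ 2 * ∫ ω, g'' (c * ∑ i ∈ Finset.range n, X i ω) ∂P|
      ≤ L * c * ∫ ω, |∑ i ∈ Finset.range m, X i ω - ∑ i ∈ Finset.range n, X i ω| ∂P := by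
    rw [← integral_const_mul, ← integral_const_mul, ← integral_const_mul,
      ← integral_sub (hg2 m) (hg2 n)]
    refine (Real.norm_eq_abs _).symm.trans_le <| norm_integral_le_of_norm_le
      (((hSi m).sub (hSi n)).abs.const_mul _) (ae_of_all _ fun ω => ?_)
    refine (hlip _ _).trans_eq ?_
    rw [← mul_sub, abs_mul, abs_of_nonneg hc, mul_assoc]
  have t3 : ∫ ω, |∑ i ∈ Finset.range m, X i ω - ∑ i ∈ Finset.range n, X i ω| ∂P
      ≤ ∫ ω, |X m ω| ∂P + b * √2 * |(n : ℝ) - ((m + 1 : ℕ) : ℝ)| ^ (1 / 2 : ℝ) := by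
    have h := integral_abs_sum_sub_sum_le hind hL h0 hvar (m + 1) n
    rw [mul_comm 2, mul_assoc, Real.sqrt_mul (sq_nonneg b), Real.sqrt_sq hb.le,
      Real.sqrt_mul zero_le_two, ← mul_assoc, Real.sqrt_eq_rpow |((m + 1 : ℕ) : ℝ) - n|,
      abs_sub_comm] at h
    have i2 := ((hSi (m + 1)).sub (hSi n)).abs
    calc _ ≤ ∫ ω, (|X m ω| + |∑ i ∈ Finset.range (m + 1), X i ω
            - ∑ i ∈ Finset.range n, X i ω|) ∂P := by
          refine integral_mono ((hSi m).sub (hSi n)).abs ((hXi m).abs.add i2) fun ω => ?_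
          dsimp only
          rw [Finset.sum_range_succ]
          refine le_trans (le_of_eq ?_) (abs_sub _ _ |>.trans_eq (add_comm _ _))
          congr 1
          ring
      _ = _ := integral_add (hXi m).abs i2
      _ ≤ _ := by gcongr
  calc _ ≤ _ := abs_sub_le _ (b ^ 2 * ∫ ω, g'' (c * ∑ i ∈ Finset.range m, X i ω) ∂P) _
    _ ≤ L * c * (ρ / (6 * b ^ 2)) + L * c * (∫ ω, |X m ω| ∂P
          + b * √2 * |(n : ℝ) - ((m + 1 : ℕ) : ℝ)| ^ (1 / 2 : ℝ)) :=
        add_le_add t1 (t2.trans (by gcongr))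
    _ = _ := by ring

end RandomSum

theorem mainTheorem5 {Ω : Type*} [MeasurableSpace Ω] (P : Measure Ω) [IsProbabilityMeasure P]
    (X : ℕ → Ω → ℝ) (N M : Ω → ℕ) (b μ ρ : ℝ)
    (hX : ∀ i, Measurable (X i)) (hN : Measurable N) (hM : Measurable M)
    (hb : 0 < b)
    (hX_indep : iIndepFun X P)
    (hX_ident : ∀ i, IdentDistrib (X i) (X 0) P P)
    (hXN : IndepFun N (fun ω i => X i ω) P)
    (hN_int : Integrable (fun ω => (N ω : ℝ)) P)
    (hμ : ∫ ω, (N ω : ℝ) ∂P = μ) (hμ_pos : 0 < μ)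
    (hX_neg : P {ω | X 0 ω < 0} = 1 / 2) (hX_pos : P {ω | 0 < X 0 ω} = 1 / 2)
    (hX_cube : Integrable (fun ω => |X 0 ω| ^ 3) P)
    (hX_mean : ∫ ω, X 0 ω ∂P = 0)
    (hX_var : ∫ ω, (X 0 ω) ^ 2 ∂P = 2 * b ^ 2)
    (hρ : ∫ ω, |X 0 ω| ^ 3 ∂P = ρ)
    (hM_law : ∀ m : ℕ, 1 ≤ m → P.real {ω | M ω = m} = μ⁻¹ * P.real {ω | m ≤ N ω}) :
    boundedLipschitzDist
        (P.map (fun ω => μ ^ (-(1 / 2) : ℝ) * ∑ i ∈ Finset.range (N ω), X i ω))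
        (laplaceDist 0 b)
      ≤ ENNReal.ofReal ((b + 2) / (b * √μ)) *
          (ENNReal.ofReal ((∫ ω, |X 0 ω| ∂P) + ρ / (6 * b ^ 2))
            + ENNReal.ofReal (b * √2) *
                ∫⁻ ω, ENNReal.ofReal (|(N ω : ℝ) - (M ω : ℝ)| ^ (1 / 2 : ℝ)) ∂P) := by
  refine iSup₂_le fun h hh => ?_
  set c : ℝ := μ ^ (-(1 / 2) : ℝ) with hc
  have hc0 : 0 ≤ c := Real.rpow_nonneg hμ_pos.le _
  have hcs : c = (√μ)⁻¹ := by rw [hc, Real.rpow_neg hμ_pos.le, Real.sqrt_eq_rpow]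
  have hcμ : μ * c ^ 2 = 1 := by
    rw [hcs, inv_pow, Real.sq_sqrt hμ_pos.le, mul_inv_cancel₀ hμ_pos.ne']
  obtain ⟨g, g', g'', hg, hg', hg0, hgC, hg'C, hlip, hstein⟩ :=
    exists_laplace_stein_solution hb hh
  set l := ∫ y, h y ∂(laplaceDist 0 b)
  set L := (b + 2) / b with hLdef
  have hhm : Measurable h := (LipschitzWith.of_dist_le_mul (K := 1) fun x y => by
    simpa [Real.dist_eq] using hh.2 x y).continuous.measurable
  have hgm : Measurable g :=
    (continuous_iff_continuousAt.2 fun x => (hg x).continuousAt).measurable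
  have hg''eq : g'' = fun x => (g x - (h x - l)) / b ^ 2 := by
    ext x
    rw [← hstein x]
    field_simp
    ring
  have hg''m : Measurable g'' := by rw [hg''eq]; fun_prop
  have hg''C : ∀ x, |g'' x| ≤ (2 + (1 + |l|)) / b ^ 2 := fun x => by
    rw [hg''eq, abs_div, abs_of_pos (show 0 < b ^ 2 by positivity)]
    gcongr
    exact (abs_sub _ _).trans (add_le_add (hgC x)
      ((abs_sub _ _).trans (by gcongr; exact hh.1 x)))
  have hcube : ∀ i, IdentDistrib (fun ω => |X i ω| ^ 3) (fun ω => |X 0 ω| ^ 3) P P := fun i =>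
    (hX_ident i).comp (u := fun x => |x| ^ 3) (by fun_prop)
  have hL0 : MemLp (X 0) 2 P := by
    have : MemLp (X 0) (3 : ℕ) P := by
      refine (integrable_norm_rpow_iff (hX 0).aestronglyMeasurable (by norm_num) (by simp)).1 ?_
      simpa using hX_cube
    exact this.mono_exponent (by norm_num)
  have hL : ∀ i, MemLp (X i) 2 P := fun i => (hX_ident i).symm.memLp_snd hL0
  set S : ℕ → Ω → ℝ := fun n ω => ∑ i ∈ Finset.range n, X i ω with hS
  have hSm : ∀ n, Measurable (S n) := fun n => Finset.measurable_sum _ fun i _ => hX i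
  set u : ℕ → ℝ := fun n => ∫ ω, g (c * S n ω) ∂P with hu
  set v : ℕ → ℝ := fun n => b ^ 2 * ∫ ω, g'' (c * S n ω) ∂P with hv
  have hu2 : ∀ n, |u n| ≤ 2 := fun n => abs_integral_le_of_abs_le fun _ => hgC _
  have hu0 : u 0 = 0 := by simp [hu, hS, hg0]
  have hd : ∀ k, |u (k + 1) - u k| ≤ 2 + 2 := fun k =>
    (abs_sub _ _).trans (add_le_add (hu2 _) (hu2 _))
  have hvb : ∀ n, |v n| ≤ b ^ 2 * ((2 + (1 + |l|)) / b ^ 2) := fun n => by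
    rw [abs_mul, abs_of_pos (show 0 < b ^ 2 by positivity)]
    gcongr
    exact abs_integral_le_of_abs_le fun _ => hg''C _
  have hWm : Measurable fun ω => c * ∑ i ∈ Finset.range (N ω), X i ω :=
    (measurable_from_prod_countable_right (f := fun p : ℕ × Ω => c * S p.1 p.2)
      fun n => (hSm n).const_mul c).comp (hN.prodMk measurable_id)
  have hm1 : MeasurableSet {ω | 1 ≤ M ω} := hM measurableSet_Ici
  set D : Ω → ℝ := {ω | 1 ≤ M ω}.indicator fun ω => u (M ω - 1 + 1) - u (M ω - 1) with hD
  have hDi : Integrable D P := (Integrable.of_bound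
    ((measurable_from_nat (f := fun m => u (m - 1 + 1) - u (m - 1))).comp hM).aestronglyMeasurable
    (2 + 2) (ae_of_all _ fun _ => hd _)).indicator hm1
  have hvi : Integrable (fun ω => v (N ω)) P := .of_bound
    ((measurable_from_nat (f := v)).comp hN).aestronglyMeasurable _ (ae_of_all _ fun _ => hvb _)
  have key : ∫ x, h x ∂(P.map fun ω => c * ∑ i ∈ Finset.range (N ω), X i ω) - l
      = ∫ ω, (μ * D ω - v (N ω)) ∂P := by
    have e1 : ∫ ω, u (N ω) ∂P = μ * ∫ ω, D ω ∂P := by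
      rw [hD, ← integral_sum_range_eq hN hM hN_int hμ_pos hM_law hd]
      simp only [Finset.sum_range_sub, hu0, sub_zero]
    have e2 := integral_randomSum hX hN hXN hgm hgC c
    have e3 := integral_randomSum hX hN hXN hg''m hg''C c
    have i1 : Integrable (fun ω => g (c * ∑ i ∈ Finset.range (N ω), X i ω)) P :=
      .of_bound (hgm.comp hWm).aestronglyMeasurable 2 (ae_of_all _ fun _ => hgC _)
    have i2 : Integrable (fun ω => g'' (c * ∑ i ∈ Finset.range (N ω), X i ω)) P :=
      .of_bound (hg''m.comp hWm).aestronglyMeasurable _ (ae_of_all _ fun _ => hg''C _)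
    have hx : ∀ x, h x = g x - b ^ 2 * g'' x + l := fun x => by rw [hstein]; ring
    rw [integral_map hWm.aemeasurable hhm.aestronglyMeasurable]
    simp only [hx]
    rw [integral_add (by exact i1.sub (i2.const_mul _)) (integrable_const _),
      integral_sub i1 (i2.const_mul _), integral_const_mul, e2, e3,
      integral_sub (hDi.const_mul μ) hvi, integral_const_mul, ← e1]
    simp only [hu, hv, hS, integral_const_mul]
    simp
  rw [key, ← Real.norm_eq_abs, ofReal_norm]
  set B : ℝ := ∫ ω, |X 0 ω| ∂P + ρ / (6 * b ^ 2) with hB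
  have hB0 : 0 ≤ B := by
    have : 0 ≤ ρ := hρ ▸ integral_nonneg fun ω => by positivity
    have : 0 ≤ ∫ ω, |X 0 ω| ∂P := integral_nonneg fun ω => abs_nonneg _
    positivity
  have hbound : ∀ᵐ ω ∂P, ‖μ * D ω - v (N ω)‖ₑ ≤ ENNReal.ofReal ((b + 2) / (b * √μ)) *
      (ENNReal.ofReal B + ENNReal.ofReal (b * √2) *
        ENNReal.ofReal (|(N ω : ℝ) - (M ω : ℝ)| ^ (1 / 2 : ℝ))) := by
    filter_upwards [ae_one_le hN hM hN_int hμ_pos hμ hM_law] with ω hω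
    have := abs_step_sub_le hX hb hμ_pos hX_indep
      (fun i => (hcube i).integrable_iff.2 hX_cube) hL
      (fun i => (hX_ident i).integral_eq.trans hX_mean)
      (fun i => ((hX_ident i).sq.integral_eq).trans hX_var)
      (fun i => (hcube i).integral_eq.trans hρ) hc0 hcμ hg hg' hgC hg'C hg''C
      (by positivity : 0 ≤ L) hlip hg''m (M ω - 1) (N ω)
    rw [← ENNReal.ofReal_mul (by positivity), ← ENNReal.ofReal_add hB0 (by positivity),
      ← ENNReal.ofReal_mul (by positivity), ← ofReal_norm, Real.norm_eq_abs]
    refine ENNReal.ofReal_le_ofReal ?_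
    rw [hD, Set.indicator_of_mem (by exact hω)]
    refine this.trans_eq ?_
    have hX1 : ∫ ω', |X (M ω - 1) ω'| ∂P = ∫ ω', |X 0 ω'| ∂P := (hX_ident _).norm.integral_eq
    rw [hX1, Nat.sub_add_cancel hω, ← hB, hcs, hLdef]
    field_simp
  calc _ ≤ _ := enorm_integral_le_lintegral_enorm _
    _ ≤ _ := lintegral_mono_ae hbound
    _ = _ := by
      rw [lintegral_const_mul' _ _ ENNReal.ofReal_ne_top,
        lintegral_add_left measurable_const, lintegral_const_mul' _ _ ENNReal.ofReal_ne_top]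
      simp
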